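/- For vectors $D=(d_1,\dots,d_p)$ in $\mathbb{R}^n$ and $k\ge 1$, the Babel function is $$\mu_k(D)=\max_{\Lambda\subset\{1,\dots,p\},\ |\Lambda|=k}\ \max_{i\notin\Lambda}\ \sum_{\lambda\in\Lambda}\left|\langle d_\lambda,d_i\rangle\right|$$ (with value $0$ if $k\ge p$, when there is no such pair $(\Lambda,i)$). Theorem. Let $n\ge 3$, $p\ge 2$ and $k\ge 1$ be integers, and let $D=(d_1,\dots,d_p)$ consist of $p$ vectors chosen independently and uniformly at random from the unit sphere $\mathbb{S}^{n-1}\subset\mathbb{R}^n$. Then $$P\left(\mu_k(D)>\tfrac12\right)\le\frac{1}{\exp\left(\dfrac{n-2}{(10\,k\log p)^2}\right)-1}.$$ -/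

import Mathlib

open MeasureTheory ProbabilityTheory

open scoped NNReal

/-- The Babel function `μ_k(D)` of a dictionary `D = (d_1, …, d_p)` of vectors of `ℝⁿ`: the maximum,
over the sets `Λ` of exactly `k` indices and the indices `i ∉ Λ`, of `∑_{l ∈ Λ} |⟨d_l, d_i⟩|`.
(It is a maximum of nonnegative numbers; for `k ≥ p` no such pair `(Λ, i)` exists and the value is
`0`, the maximum over the empty family in `ℝ≥0`.) -/
noncomputable def babel {n p : ℕ} (k : ℕ) (D : Fin p → EuclideanSpace ℝ (Fin n)) : ℝ≥0 :=
  (Finset.univ.powersetCard k).sup fun Λ : Finset (Fin p) =>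
    Λᶜ.sup fun i => ∑ l ∈ Λ, ‖inner ℝ (D l) (D i)‖₊

/-- The uniform probability distribution on the unit sphere of `ℝⁿ` (for `1 ≤ n`): the surface
measure induced by Lebesgue measure, normalized to have total mass `1`. -/
noncomputable def uniformSphere (n : ℕ) :
    Measure (Metric.sphere (0 : EuclideanSpace ℝ (Fin n)) 1) :=
  ((volume : Measure (EuclideanSpace ℝ (Fin n))).toSphere Set.univ)⁻¹ •
    (volume : Measure (EuclideanSpace ℝ (Fin n))).toSphere

open scoped Pointwise

/-! If no pair of distinct vectors has inner product at least `1/(2k)` in absolute value, every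
`k`-term sum is at most `1/2`. A union bound over pairs therefore reduces the theorem to two
independent vectors, and Fubini to a fixed axis: `uniformSphere_cap_le` bounds a cap by the volume
of a ball containing its cone. This gives `2 p² exp(-n/(8k²))`. With `x` the exponent in the
theorem, this is at most `exp(-x)` once `x ≥ log 2` (`sq_mul_exp_le_exp_neg`); for smaller `x` the
claimed bound is at least `1`. -/

open Metric in
/-- A spherical cap of height `ε ≤ 1/√2`, coned off at the origin, lies in the ball of radius
`√(1 - ε²)` around the point at height `ε` on the axis. -/
theorem cone_cap_subset_closedBall {E : Type*} [NormedAddCommGroup E] [InnerProductSpace ℝ E]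
    {e : E} (he : ‖e‖ = 1) {ε : ℝ} (hε : 0 ≤ ε) (hε' : ε ^ 2 ≤ 1 / 2) :
    Set.Ioo (0 : ℝ) 1 • (((↑) : sphere (0 : E) 1 → E) '' {u | ε ≤ inner ℝ (u : E) e}) ⊆
      closedBall (ε • e) √(1 - ε ^ 2) := by
  rintro _ ⟨r, ⟨hr0, hr1⟩, _, ⟨u, hu, rfl⟩, rfl⟩
  have hu' : ε ≤ inner ℝ (u : E) e := hu
  have hun : ‖(u : E)‖ = 1 := norm_eq_of_mem_sphere u
  rw [mem_closedBall, dist_eq_norm]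
  apply Real.le_sqrt_of_sq_le
  have key : ‖r • (u : E) - ε • e‖ ^ 2 = r ^ 2 - 2 * (r * ε * inner ℝ (u : E) e) + ε ^ 2 := by
    rw [norm_sub_sq_real, norm_smul, norm_smul, hun, he, inner_smul_left, inner_smul_right]
    simp only [Real.norm_eq_abs, mul_one, sq_abs, conj_trivial]
    ring
  simp only [key]
  have h1 : r * ε * ε ≤ r * ε * inner ℝ (u : E) e := by gcongr
  -- After `h1`, the slack is at least `(1 - r)(1 + r - 2ε²)`, which is nonnegative because `2ε² ≤
  -- 1`.
  nlinarith [mul_pos hr0 (sub_pos.2 hr1)]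

/-- Concentration of measure on the sphere: a cap of height `ε` has uniform measure at most
`exp (-n ε² / 2)`. -/
theorem uniformSphere_cap_le {n : ℕ} (hn : 0 < n) (e : EuclideanSpace ℝ (Fin n)) (he : ‖e‖ = 1)
    {ε : ℝ} (hε : 0 ≤ ε) (hε' : ε ^ 2 ≤ 1 / 2) :
    uniformSphere n {u | ε ≤ inner ℝ (u : EuclideanSpace ℝ (Fin n)) e} ≤
      ENNReal.ofReal (Real.exp (-(n * ε ^ 2 / 2))) := by
  have : Nonempty (Fin n) := ⟨⟨0, hn⟩⟩
  set B := volume (Metric.ball (0 : EuclideanSpace ℝ (Fin n)) 1) with hB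
  have hB0 : B ≠ 0 := (Metric.measure_ball_pos _ _ one_pos).ne'
  have hBt : B ≠ ⊤ := measure_ball_lt_top.ne
  have hn0 : (n : ENNReal) ≠ 0 := by exact_mod_cast hn.ne'
  have hms : MeasurableSet {u : Metric.sphere (0 : EuclideanSpace ℝ (Fin n)) 1 |
      ε ≤ inner ℝ (u : EuclideanSpace ℝ (Fin n)) e} :=
    (isClosed_le continuous_const (by fun_prop)).measurableSet
  rw [uniformSphere, Measure.smul_apply, Measure.toSphere_apply' _ hms,
    Measure.toSphere_apply_univ, smul_eq_mul, finrank_euclideanSpace, Fintype.card_fin, ← hB]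
  have hsq : √(1 - ε ^ 2) ^ n ≤ Real.exp (-(n * ε ^ 2 / 2)) := by
    have h1 : √(1 - ε ^ 2) ≤ Real.exp (-(ε ^ 2 / 2)) := by
      rw [Real.sqrt_le_left (Real.exp_pos _).le, ← Real.exp_nat_mul]
      have := Real.add_one_le_exp (-ε ^ 2)
      have h2 : ((2 : ℕ) : ℝ) * -(ε ^ 2 / 2) = -ε ^ 2 := by push_cast; ring
      rw [h2]
      linarith
    calc √(1 - ε ^ 2) ^ n ≤ Real.exp (-(ε ^ 2 / 2)) ^ n := by gcongr
      _ = _ := by rw [← Real.exp_nat_mul]; congr 1; ring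
  have hvol : volume (Set.Ioo (0 : ℝ) 1 •
      (((↑) : Metric.sphere (0 : EuclideanSpace ℝ (Fin n)) 1 → EuclideanSpace ℝ (Fin n)) ''
        {u | ε ≤ inner ℝ (u : EuclideanSpace ℝ (Fin n)) e})) ≤
      ENNReal.ofReal (Real.exp (-(n * ε ^ 2 / 2))) * B := by
    refine (measure_mono (cone_cap_subset_closedBall he hε hε')).trans ?_
    rw [Measure.addHaar_closedBall _ _ (Real.sqrt_nonneg _), finrank_euclideanSpace,
      Fintype.card_fin]
    gcongr
  -- The surface measure is `n` times the volume of the cone, so the factors `n` cancel after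
  -- normalization.
  calc _ ≤ ((n : ENNReal) * B)⁻¹ * (n * (ENNReal.ofReal (Real.exp (-(n * ε ^ 2 / 2))) * B)) := by
        gcongr
    _ = ((n : ENNReal) * B)⁻¹ * (n * B) * ENNReal.ofReal (Real.exp (-(n * ε ^ 2 / 2))) := by ring
    _ = _ := by
        rw [ENNReal.inv_mul_cancel (mul_ne_zero hn0 hB0)
          (ENNReal.mul_ne_top (ENNReal.natCast_ne_top n) hBt), one_mul]

theorem uniformSphere_abs_inner_le {n : ℕ} (hn : 0 < n) (e : EuclideanSpace ℝ (Fin n))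
    (he : ‖e‖ = 1) {ε : ℝ} (hε : 0 ≤ ε) (hε' : ε ^ 2 ≤ 1 / 2) :
    uniformSphere n {u | ε ≤ |inner ℝ (u : EuclideanSpace ℝ (Fin n)) e|} ≤
      ENNReal.ofReal (2 * Real.exp (-(n * ε ^ 2 / 2))) := by
  have hsub : {u : Metric.sphere (0 : EuclideanSpace ℝ (Fin n)) 1 |
      ε ≤ |inner ℝ (u : EuclideanSpace ℝ (Fin n)) e|} ⊆
      {u | ε ≤ inner ℝ (u : EuclideanSpace ℝ (Fin n)) e} ∪
      {u | ε ≤ inner ℝ (u : EuclideanSpace ℝ (Fin n)) (-e)} := by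
    intro u hu
    simpa only [Set.mem_union, Set.mem_ofPred_eq, inner_neg_right, le_abs] using hu
  refine (measure_mono hsub).trans ((measure_union_le _ _).trans ?_)
  rw [two_mul, ENNReal.ofReal_add (Real.exp_pos _).le (Real.exp_pos _).le]
  exact add_le_add (uniformSphere_cap_le hn e he hε hε')
    (uniformSphere_cap_le hn (-e) (by rwa [norm_neg]) hε hε')

/-- Two independent uniform vectors of the sphere are almost orthogonal with high probability. -/
theorem measure_abs_inner_le_of_indepFun {Ω : Type*} [MeasurableSpace Ω] {P : Measure Ω}
    [IsProbabilityMeasure P] {n : ℕ} (hn : 0 < n)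
    {X Y : Ω → Metric.sphere (0 : EuclideanSpace ℝ (Fin n)) 1}
    (hX : HasLaw X (uniformSphere n) P) (hY : HasLaw Y (uniformSphere n) P)
    (hXY : IndepFun X Y P) {ε : ℝ} (hε : 0 ≤ ε) (hε' : ε ^ 2 ≤ 1 / 2) :
    P {ω | ε ≤ |inner ℝ (X ω : EuclideanSpace ℝ (Fin n)) (Y ω)|} ≤
      ENNReal.ofReal (2 * Real.exp (-(n * ε ^ 2 / 2))) := by
  have hprob : IsProbabilityMeasure (uniformSphere n) :=
    hX.map_eq ▸ Measure.isProbabilityMeasure_map hX.aemeasurable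
  set S := {z : Metric.sphere (0 : EuclideanSpace ℝ (Fin n)) 1 ×
      Metric.sphere (0 : EuclideanSpace ℝ (Fin n)) 1 |
      ε ≤ |inner ℝ (z.1 : EuclideanSpace ℝ (Fin n)) z.2|}
  have hS : MeasurableSet S := (isClosed_le continuous_const (by fun_prop)).measurableSet
  have hmap : P.map (fun ω => (X ω, Y ω)) = (uniformSphere n).prod (uniformSphere n) := by
    rw [(indepFun_iff_map_prod_eq_prod_map_map hX.aemeasurable hY.aemeasurable).1 hXY,
      hX.map_eq, hY.map_eq]
  have hpre : P {ω | ε ≤ |inner ℝ (X ω : EuclideanSpace ℝ (Fin n)) (Y ω)|} =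
      (uniformSphere n).prod (uniformSphere n) S := by
    rw [← hmap, Measure.map_apply_of_aemeasurable (hX.aemeasurable.prodMk hY.aemeasurable) hS]
    rfl
  -- Fubini: freeze the second vector as the axis; the cap bound does not depend on it.
  rw [hpre, Measure.prod_apply_symm hS]
  calc _ ≤ ∫⁻ _, ENNReal.ofReal (2 * Real.exp (-(n * ε ^ 2 / 2))) ∂(uniformSphere n) :=
        lintegral_mono fun y =>
          uniformSphere_abs_inner_le hn y (norm_eq_of_mem_sphere y) hε hε'
    _ = _ := by simp

/-- If all pairs of distinct vectors have small inner product, then so does the Babel function. -/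
theorem babel_le_of_forall_abs_inner_le {n p k : ℕ} {D : Fin p → EuclideanSpace ℝ (Fin n)} {ε : ℝ}
    (hε : 0 ≤ ε) (h : ∀ i j, i ≠ j → |inner ℝ (D i) (D j)| ≤ ε) :
    (babel k D : ℝ) ≤ k * ε := by
  lift ε to ℝ≥0 using hε
  suffices babel k D ≤ k * ε by exact_mod_cast this
  refine Finset.sup_le fun Λ hΛ => Finset.sup_le fun i hi => ?_
  rw [← (Finset.mem_powersetCard.1 hΛ).2, ← nsmul_eq_mul]
  refine Finset.sum_le_card_nsmul _ _ _ fun l hl => ?_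
  rw [← NNReal.coe_le_coe, coe_nnnorm, Real.norm_eq_abs]
  exact h l i fun hli => Finset.mem_compl.1 hi (hli ▸ hl)

theorem measure_babel_gt_half_le {Ω : Type*} [MeasurableSpace Ω] (P : Measure Ω)
    [IsProbabilityMeasure P] {n p k : ℕ} (hn : 0 < n) (hk : 1 ≤ k)
    (d : Fin p → Ω → Metric.sphere (0 : EuclideanSpace ℝ (Fin n)) 1)
    (hunif : ∀ i, HasLaw (d i) (uniformSphere n) P) (hindep : iIndepFun d P) :
    P.real {ω | (1 / 2 : ℝ) <
        (babel k (fun i => (d i ω : EuclideanSpace ℝ (Fin n))) : ℝ)} ≤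
      (p : ℝ) ^ 2 * (2 * Real.exp (-(n / (8 * (k : ℝ) ^ 2)))) := by
  have hk' : (1 : ℝ) ≤ k := by exact_mod_cast hk
  -- Chosen so that `k * ε = 1/2`.
  set ε : ℝ := 1 / (2 * k) with hεdef
  have hε : 0 ≤ ε := by positivity
  have hε' : ε ^ 2 ≤ 1 / 2 := by
    have : ε ≤ 1 / 2 := by
      rw [hεdef]
      exact one_div_le_one_div_of_le two_pos (by linarith)
    nlinarith
  have hexp : (n : ℝ) * ε ^ 2 / 2 = n / (8 * (k : ℝ) ^ 2) := by
    rw [hεdef]; field_simp; norm_num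
  have hsub : {ω | (1 / 2 : ℝ) < (babel k (fun i => (d i ω : EuclideanSpace ℝ (Fin n))) : ℝ)} ⊆
      ⋃ z ∈ (Finset.univ : Finset (Fin p)).offDiag,
        {ω | ε ≤ |inner ℝ (d z.1 ω : EuclideanSpace ℝ (Fin n)) (d z.2 ω)|} := by
    intro ω hω
    by_contra hcon
    simp only [Set.mem_iUnion, Set.mem_ofPred_eq, not_exists, not_le, Finset.mem_offDiag,
      Finset.mem_univ, true_and] at hcon
    have hle := babel_le_of_forall_abs_inner_le (k := k)
      (D := fun i => (d i ω : EuclideanSpace ℝ (Fin n))) hε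
      (fun i j hij => (hcon (i, j) hij).le)
    have : (k : ℝ) * ε = 1 / 2 := by rw [hεdef]; field_simp
    rw [this] at hle
    exact absurd hω hle.not_gt
  calc _ ≤ P.real (⋃ z ∈ (Finset.univ : Finset (Fin p)).offDiag,
        {ω | ε ≤ |inner ℝ (d z.1 ω : EuclideanSpace ℝ (Fin n)) (d z.2 ω)|}) :=
        measureReal_mono hsub (measure_ne_top _ _)
    _ ≤ ∑ z ∈ (Finset.univ : Finset (Fin p)).offDiag,
        P.real {ω | ε ≤ |inner ℝ (d z.1 ω : EuclideanSpace ℝ (Fin n)) (d z.2 ω)|} :=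
        measureReal_biUnion_finset_le _ _
    _ ≤ ∑ _z ∈ (Finset.univ : Finset (Fin p)).offDiag,
        2 * Real.exp (-(n / (8 * (k : ℝ) ^ 2))) := by
        refine Finset.sum_le_sum fun z hz => ?_
        rw [← hexp]
        exact ENNReal.toReal_le_of_le_ofReal (by positivity)
          (measure_abs_inner_le_of_indepFun hn (hunif _) (hunif _)
            (hindep.indepFun (Finset.mem_offDiag.1 hz).2.2) hε hε')
    _ ≤ _ := by
        rw [Finset.sum_const, nsmul_eq_mul]
        gcongr
        rw [Finset.offDiag_card, Finset.card_univ, Fintype.card_fin, sq]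
        exact_mod_cast Nat.sub_le _ _

/-- In logarithms, with `L = log p`, this says `2L + log 2 + x ≤ (25/2) x L²`. Since `x` and `L` are
at least `log 2 > 0.69`, each term on the left is at most a constant times `x L²`, and the constants
sum to less than `25/2`, which is `10²/8`. -/
theorem sq_mul_exp_le_exp_neg {p x : ℝ} (hp : 2 ≤ p) (hx : Real.log 2 ≤ x) :
    p ^ 2 * (2 * Real.exp (-(25 / 2 * x * Real.log p ^ 2))) ≤ Real.exp (-x) := by
  have hl : 0.69 < Real.log 2 := by linarith [Real.log_two_gt_d9]
  have hL : Real.log 2 ≤ Real.log p := Real.log_le_log two_pos hp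
  have hp' : p ^ 2 * (2 * Real.exp (-(25 / 2 * x * Real.log p ^ 2))) =
      Real.exp (2 * Real.log p + Real.log 2 - 25 / 2 * x * Real.log p ^ 2) := by
    rw [sub_eq_add_neg, Real.exp_add, Real.exp_add, two_mul (Real.log p), Real.exp_add,
      Real.exp_log (by linarith), Real.exp_log two_pos]
    ring
  rw [hp', Real.exp_le_exp]
  set L := Real.log p
  have h1 : 0.69 ≤ L := by linarith
  have h2 : 0.69 ≤ x := by linarith
  have h3 : 0.69 * L ≤ x * L := by gcongr
  have h4 : x * L * 0.69 ≤ x * L * L := by gcongr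
  have h5 : x * 0.69 ≤ x * L := by gcongr
  nlinarith

theorem theorem4 {Ω : Type*} [MeasurableSpace Ω] (P : Measure Ω) [IsProbabilityMeasure P]
    (n p k : ℕ) (hn : 2 < n) (hp : 2 ≤ p) (hk : 1 ≤ k)
    (d : Fin p → Ω → Metric.sphere (0 : EuclideanSpace ℝ (Fin n)) 1)
    (hunif : ∀ i, HasLaw (d i) (uniformSphere n) P)
    (hindep : iIndepFun d P) :
    P.real {ω | (1 / 2 : ℝ) <
        (babel k (fun i => (d i ω : EuclideanSpace ℝ (Fin n))) : ℝ)} ≤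
      1 / (Real.exp (((n : ℝ) - 2) / (10 * (k : ℝ) * Real.log (p : ℝ)) ^ 2) - 1) := by
  have hp' : (2 : ℝ) ≤ p := by exact_mod_cast hp
  have hn' : (2 : ℝ) < n := by exact_mod_cast hn
  have hk' : (0 : ℝ) < k := by exact_mod_cast hk
  have hL : 0 < Real.log p := Real.log_pos (by linarith)
  set x : ℝ := ((n : ℝ) - 2) / (10 * (k : ℝ) * Real.log (p : ℝ)) ^ 2 with hx
  have hx0 : 0 < x := div_pos (by linarith) (by positivity)
  have hpos : 0 < Real.exp x - 1 := by linarith [Real.add_one_lt_exp hx0.ne']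
  rcases le_total x (Real.log 2) with hxl | hxl
  -- Here `exp x ≤ 2`, so the right-hand side is at least `1`.
  · refine measureReal_le_one.trans ((one_le_div hpos).2 ?_)
    have := Real.exp_le_exp.2 hxl
    rw [Real.exp_log two_pos] at this
    linarith
  · refine (measure_babel_gt_half_le P (by omega) hk d hunif hindep).trans ?_
    have hexp : 25 / 2 * x * Real.log p ^ 2 = ((n : ℝ) - 2) / (8 * (k : ℝ) ^ 2) := by
      rw [hx]; field_simp; ring
    calc _ ≤ (p : ℝ) ^ 2 * (2 * Real.exp (-(25 / 2 * x * Real.log p ^ 2))) := by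
          -- The exponent is weakened from `n` to `n - 2`.
          rw [hexp]
          gcongr
          linarith
      _ ≤ Real.exp (-x) := sq_mul_exp_le_exp_neg hp' hxl
      _ ≤ _ := by
          rw [Real.exp_neg, ← one_div]
          exact one_div_le_one_div_of_le hpos (by linarith)
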